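/- Let $X_t=\mu_t+e_t$, $t\ge 1$, be real random variables with $\mu_t\in\mathbb R$ and $Ee_t=0$, and suppose that the hypothesis of no change $H_0$ holds, i.e. $\mu_1=\mu_2=\dots=\mu_T$ for every sample size $T$. Let $t_T$ be real numbers with $t_T\to\infty$ and $t_T/T\to 0$ as $T\to\infty$, and put $$D_T=\max_{t_T\le t\le T-t_T}\left|\frac1t\sum_{s=1}^tX_s-\frac1{T-t}\sum_{s=t+1}^TX_s\right|,$$ the maximum being over integers $t$ (such $t$ exist for all large $T$). Let $\sigma>0$ and $0<\kappa<1/2$, and assume that for each $T$ there are independent Wiener processes $\{W_{T,1}(x),\,0\le x\le T/2\}$ and $\{W_{T,2}(x),\,0\le x\le T/2\}$, defined on the same probability space as the $e_t$, such that, as $T\to\infty$, $$\sup_{1\le x\le T/2}x^{-\kappa}\left|\sum_{s=1}^{\lfloor x\rfloor}e_s-\sigma W_{T,1}(x)\right|=O_P(1) \quad\text{and}\quad \sup_{T/2\le x\le T-1}(T-x)^{-\kappa}\left|\sum_{s=\lfloor x\rfloor+1}^{T}e_s-\sigma W_{T,2}(T-x)\right|=O_P(1).$$ Then, as $T\to\infty$,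 $$t_T^{1/2}\,\frac{D_T}{\sigma}\ \xrightarrow{\ \mathcal D\ }\ \max(\xi_1,\xi_2),$$ where $\xi_1,\xi_2$ are independent and each has the distribution of $\xi=\sup_{0\le u\le1}|W(u)|$, with $\{W(u),\,0\le u\le 1\}$ a Wiener process. -/

import Mathlib

open MeasureTheory ProbabilityTheory Filter Topology
open scoped NNReal ENNReal

/-- `W` is a (standard) Wiener process on the time interval `[0, a]`: its finite-dimensional laws at
times in `[0, a]` are those of Brownian motion (centred Gaussian vectors with covariance
`min s t`), and almost all its paths are continuous on `[0, a]`. Nothing is required of `W` at times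
beyond `a`. For processes on the whole half-line this is Mathlib's `IsBrownianReal`. -/
structure IsWienerOn {Ω : Type*} [MeasurableSpace Ω] (a : ℝ≥0) (W : ℝ≥0 → Ω → ℝ)
    (P : Measure Ω) : Prop where
  hasLaw : ∀ I : Finset ℝ≥0, (∀ u ∈ I, u ≤ a) →
    HasLaw (fun ω ↦ I.restrict (W · ω)) (BrownianReal.projectiveFamily I) P
  cont : ∀ᵐ ω ∂P, ContinuousOn (W · ω) (Set.Icc 0 a)

/-- `W` and `W'`, as processes on `[0, a]`, are independent (with respect to the product
σ-algebras on the path spaces). -/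
def IndepProcessesOn {Ω : Type*} [MeasurableSpace Ω] (a : ℝ≥0) (W W' : ℝ≥0 → Ω → ℝ)
    (P : Measure Ω) : Prop :=
  IndepFun (fun ω (u : Set.Icc (0 : ℝ≥0) a) ↦ W u ω) (fun ω (u : Set.Icc (0 : ℝ≥0) a) ↦ W' u ω) P

/-- `Y T = O_P(1)` as `T → ∞`, for variables with values in `[0, ∞]`: bounded in probability. -/
def IsBoundedInProb {Ω : Type*} [MeasurableSpace Ω] (Y : ℕ → Ω → ℝ≥0∞) (P : Measure Ω) : Prop :=
  ∀ ε : ℝ≥0∞, 0 < ε → ∃ M : ℝ≥0, ∀ᶠ T : ℕ in atTop, P {ω | (M : ℝ≥0∞) < Y T ω} ≤ ε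

/-- `sup_{1 ≤ x ≤ T/2} x^{-κ} |∑_{s = 1}^{⌊x⌋} e_s - σ W(x)|`. -/
noncomputable def forwardError {Ω : Type*} (e : ℕ → Ω → ℝ) (σ κ : ℝ) (W : ℝ≥0 → Ω → ℝ) (T : ℕ)
    (ω : Ω) : ℝ≥0∞ :=
  ⨆ x ∈ Set.Icc (1 : ℝ) ((T : ℝ) / 2),
    ENNReal.ofReal (x ^ (-κ) * |∑ s ∈ Finset.Icc 1 ⌊x⌋₊, e s ω - σ * W x.toNNReal ω|)

/-- `sup_{T/2 ≤ x ≤ T-1} (T-x)^{-κ} |∑_{s = ⌊x⌋+1}^{T} e_s - σ W(T-x)|`. -/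
noncomputable def backwardError {Ω : Type*} (e : ℕ → Ω → ℝ) (σ κ : ℝ) (W : ℝ≥0 → Ω → ℝ) (T : ℕ)
    (ω : Ω) : ℝ≥0∞ :=
  ⨆ x ∈ Set.Icc ((T : ℝ) / 2) ((T : ℝ) - 1),
    ENNReal.ofReal (((T : ℝ) - x) ^ (-κ) *
      |∑ s ∈ Finset.Icc (⌊x⌋₊ + 1) T, e s ω - σ * W ((T : ℝ) - x).toNNReal ω|)

/-- For every `T` there are two independent Wiener processes on `[0, T/2]` which approximate,
at rate `x^κ`, the partial sums of `e_1, …, e_T` taken from the left end and from the right end. -/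
def HasTwoSidedApprox {Ω : Type*} [MeasurableSpace Ω] (e : ℕ → Ω → ℝ) (σ κ : ℝ)
    (P : Measure Ω) : Prop :=
  ∃ W₁ W₂ : ℕ → ℝ≥0 → Ω → ℝ,
    (∀ T : ℕ, IsWienerOn ((T : ℝ≥0) / 2) (W₁ T) P ∧ IsWienerOn ((T : ℝ≥0) / 2) (W₂ T) P ∧
      IndepProcessesOn ((T : ℝ≥0) / 2) (W₁ T) (W₂ T) P) ∧
    IsBoundedInProb (fun T ↦ forwardError e σ κ (W₁ T) T) P ∧
    IsBoundedInProb (fun T ↦ backwardError e σ κ (W₂ T) T) P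

/-- Difference of the sample means of `x_1, …, x_t` and of `x_{t+1}, …, x_T`. -/
noncomputable def sampleMeanDiff (x : ℕ → ℝ) (T t : ℕ) : ℝ :=
  1 / (t : ℝ) * ∑ s ∈ Finset.Icc 1 t, x s
    - 1 / ((T : ℝ) - (t : ℝ)) * ∑ s ∈ Finset.Icc (t + 1) T, x s

/-- The Rényi statistic `D_T`: the maximum of `|sampleMeanDiff x T t|` over the integers `t` with
`τ ≤ t ≤ T - τ`. The maximum of these nonnegative numbers is taken in `ℝ≥0`, so it is `0` if there
is no such `t`. -/
noncomputable def renyiStat (x : ℕ → ℝ) (τ : ℝ) (T : ℕ) : ℝ :=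
  (((Finset.range (T + 1)).filter fun t : ℕ ↦ τ ≤ (t : ℝ) ∧ (t : ℝ) ≤ (T : ℝ) - τ).sup
    fun t ↦ ‖sampleMeanDiff x T t‖₊ : ℝ≥0)

/-! Under the null hypothesis the common mean cancels in every difference of sample means, so only
the errors matter. For `t ≤ T/2` the left mean is approximately `σ W₁(t)/t`. The right mean averages
at least `T/2` terms, so after multiplication by `√τ` it is negligible because `τ/T → 0`. The
approximation error per unit of time is at most a multiple of `τ^(κ-1)`, and `√τ · τ^(κ-1) → 0`
since `κ < 1/2`. The range `t ≥ T/2` is the mirror image, with `W₂`. Hence the statistic is close to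
the larger of the maxima of `√τ |Wᵢ(s)|/s` over a finite grid in `[τ, T/2]`
(`abs_renyiStat_sub_le`).

By time inversion, the vector of values `√τ W(s)/s` has the law of the values `B(τ/s)` of a Wiener
process on `[0,1]` (`identDistrib_inversion`); on a finite grid this is only a comparison of
Gaussian covariances. The points `τ/s` fill up `(0,1]`, so along a continuous path the grid maximum
tends to the supremum (`tendsto_norm_gridPath`). The processes `W₁`, `W₂` change with `T`. Their
laws are therefore realised on a product space by one fixed pair of independent paths, where
convergence is almost sure. The negligible terms are controlled in the same way through
`weightedNorm`. -/

/-! ### Gaussian vectors are determined by means and covariances -/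

/-- Gaussian vectors with the same means and covariances have the same law. -/
theorem HasGaussianLaw.identDistrib_of_covariance {Ω Ω' ι : Type*} [MeasurableSpace Ω]
    [MeasurableSpace Ω'] [Fintype ι] {P : Measure Ω} {P' : Measure Ω'} {X : Ω → ι → ℝ}
    {Y : Ω' → ι → ℝ} (hX : HasGaussianLaw X P) (hY : HasGaussianLaw Y P')
    (hmean : ∀ i, ∫ ω, X ω i ∂P = ∫ ω, Y ω i ∂P')
    (hcov : ∀ i j, cov[fun ω ↦ X ω i, fun ω ↦ X ω j; P] =
      cov[fun ω ↦ Y ω i, fun ω ↦ Y ω j; P']) :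
    IdentDistrib X Y P P' where
  aemeasurable_fst := hX.aemeasurable
  aemeasurable_snd := hY.aemeasurable
  map_eq := by
    have hPX := hX.isProbabilityMeasure
    have hPY := hY.isProbabilityMeasure
    -- The covariance bilinear form lives on an inner product space, hence the passage to Euclidean
    -- space and back.
    let L : (ι → ℝ) ≃L[ℝ] EuclideanSpace ℝ ι := (PiLp.continuousLinearEquiv 2 ℝ (fun _ : ι ↦ ℝ)).symm
    have hLX := (hX.map_equiv L).isGaussian_map
    have hLY := (hY.map_equiv L).isGaussian_map
    have mX (i : ι) : MemLp (fun ω ↦ X ω i) 2 P := (hX.eval i).memLp_two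
    have mY (i : ι) : MemLp (fun ω ↦ Y ω i) 2 P' := (hY.eval i).memLp_two
    have key : P.map (L ∘ X) = P'.map (L ∘ Y) := by
      apply IsGaussian.ext
      · rw [integral_map (by fun_prop) (by fun_prop), integral_map (by fun_prop) (by fun_prop)]
        simp only [id_eq, Function.comp_apply]
        rw [ContinuousLinearEquiv.integral_comp_comm, ContinuousLinearEquiv.integral_comp_comm]
        congr 1
        ext i
        rw [eval_integral fun i ↦ (mX i).integrable (by norm_num),
          eval_integral fun i ↦ (mY i).integrable (by norm_num), hmean]
      -- A symmetric bilinear form is determined by its diagonal.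
      · rw [← ContinuousLinearMap.toBilinForm_inj]
        refine LinearMap.BilinForm.ext_of_isSymm isPosSemidef_covarianceBilin.isSymm
          isPosSemidef_covarianceBilin.isSymm fun x ↦ ?_
        simp only [ContinuousLinearMap.toBilinForm_apply]
        have h1 := covarianceBilin_apply_pi (μ := P) (X := fun i ω ↦ X ω i) mX x x
        have h2 := covarianceBilin_apply_pi (μ := P') (X := fun i ω ↦ Y ω i) mY x x
        refine h1.trans (Eq.trans ?_ h2.symm)
        exact Finset.sum_congr rfl fun i _ ↦ Finset.sum_congr rfl fun j _ ↦ by rw [hcov]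
    have := congrArg (Measure.map L.symm) key
    rw [AEMeasurable.map_map_of_aemeasurable (by fun_prop) (by fun_prop),
      AEMeasurable.map_map_of_aemeasurable (by fun_prop) (by fun_prop)] at this
    simpa [← Function.comp_assoc] using this

/-! ### Finite-dimensional laws of a Wiener process and time inversion -/

namespace IsWienerOn

variable {Ω : Type*} [MeasurableSpace Ω] {a : ℝ≥0} {W : ℝ≥0 → Ω → ℝ} {P : Measure Ω}

lemma hasGaussianLaw_mul (hW : IsWienerOn a W P) {ι : Type*} [Fintype ι] {s : ι → ℝ≥0}
    (hs : ∀ i, s i ≤ a) (c : ι → ℝ) : HasGaussianLaw (fun ω i ↦ c i * W (s i) ω) P := by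
  classical
  have h := (hW.hasLaw (Finset.univ.image s) (by simpa using hs)).hasGaussianLaw
  exact h.map_fun (.pi fun i ↦ c i • .proj (R := ℝ)
    (⟨s i, by simp⟩ : ↥(Finset.univ.image s)))

lemma hasGaussianLaw_eval (hW : IsWienerOn a W P) {s : ℝ≥0} (hs : s ≤ a) :
    HasGaussianLaw (W s) P := by
  simpa using (hW.hasGaussianLaw_mul (ι := Unit) (s := fun _ ↦ s) (fun _ ↦ hs) 1).eval ()

lemma integral_eval (hW : IsWienerOn a W P) {s : ℝ≥0} (hs : s ≤ a) : ∫ ω, W s ω ∂P = 0 := by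
  have h := (hW.hasLaw {s} (by simpa using hs)).integral_comp
    (f := fun x : ({s} : Finset ℝ≥0) → ℝ ↦ x ⟨s, by simp⟩)
    (measurable_pi_apply _).aestronglyMeasurable
  rw [BrownianReal.integral_eval_projectiveFamily] at h
  exact h

lemma covariance_eval (hW : IsWienerOn a W P) {s t : ℝ≥0} (hs : s ≤ a) (ht : t ≤ a) :
    cov[W s, W t; P] = min s t := by
  have h := (hW.hasLaw {s, t} (by simp [hs, ht])).covariance_fun_comp
    (f := fun x ↦ x ⟨s, by simp⟩) (g := fun x ↦ x ⟨t, by simp⟩)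
    (measurable_pi_apply _).aemeasurable (measurable_pi_apply _).aemeasurable
  rw [BrownianReal.covariance_eval_projectiveFamily] at h
  exact h

/-- The law at time `0` is Gaussian with variance `0`, that is, a Dirac mass. -/
lemma eval_zero (hW : IsWienerOn a W P) : ∀ᵐ ω ∂P, W 0 ω = 0 := by
  have h := (BrownianReal.measurePreserving_eval_projectiveFamily
    (I := {0}) ⟨0, by simp⟩).hasLaw.comp (hW.hasLaw {0} (by simp))
  rw [gaussianReal_zero_var] at h
  exact h.ae_eq_of_dirac

/-- **Time inversion**, at finitely many times. -/
theorem identDistrib_inversion (hW : IsWienerOn a W P) {Ω' : Type*} [MeasurableSpace Ω']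
    {P' : Measure Ω'} {b : ℝ≥0} {B : ℝ≥0 → Ω' → ℝ} (hB : IsWienerOn b B P') {ι : Type*} [Fintype ι]
    {s : ι → ℝ≥0} (hs0 : ∀ i, 0 < s i) (hs : ∀ i, s i ≤ a) {r : ℝ≥0} (hr : ∀ i, r / s i ≤ b) :
    IdentDistrib (fun ω i ↦ Real.sqrt r / s i * W (s i) ω) (fun ω i ↦ B (r / s i) ω) P P' := by
  refine HasGaussianLaw.identDistrib_of_covariance (hW.hasGaussianLaw_mul hs _) ?_ ?_ ?_
  · simpa using hB.hasGaussianLaw_mul hr 1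
  · intro i
    rw [integral_const_mul, hW.integral_eval (hs i), hB.integral_eval (hr i), mul_zero]
  · intro i j
    -- The identity behind inversion is `r · min(s, t) / (s t) = min(r/s, r/t)`.
    rw [covariance_const_mul_left, covariance_const_mul_right, hW.covariance_eval (hs i) (hs j)]
    refine Eq.trans ?_ (hB.covariance_eval (hr i) (hr j)).symm
    have hi := NNReal.coe_pos.2 (hs0 i)
    have hj := NNReal.coe_pos.2 (hs0 j)
    have hr2 : Real.sqrt r * Real.sqrt r = r := Real.mul_self_sqrt r.2
    rw [NNReal.coe_min, NNReal.coe_min, NNReal.coe_div, NNReal.coe_div]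
    have e : ∀ m : ℝ, Real.sqrt r / s i * (Real.sqrt r / s j * m) = r * m / (s i * s j) := by
      intro m
      rw [← hr2]; field_simp; rw [Real.sqrt_sq (Real.sqrt_nonneg _)]
    rw [e]
    rcases le_total (s i : ℝ) (s j) with h | h
    · rw [min_eq_left h, min_eq_right (div_le_div_of_nonneg_left r.coe_nonneg hi h)]
      field_simp
    · rw [min_eq_right h, min_eq_left (div_le_div_of_nonneg_left r.coe_nonneg hj h)]
      field_simp

end IsWienerOn

/-! ### The finite grid and its norms -/

/-- The integers in `[τ, T / 2]`, together with `T / 2`. -/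
noncomputable def halfGrid (τ : ℝ) (T : ℕ) : Finset ℝ≥0 :=
  insert ((T : ℝ≥0) / 2) (((Finset.range (T + 1)).filter fun t : ℕ ↦
    τ ≤ (t : ℝ) ∧ (t : ℝ) ≤ (T : ℝ) / 2).image fun t : ℕ ↦ (t : ℝ≥0))

lemma half_mem_halfGrid (τ : ℝ) (T : ℕ) : (T : ℝ≥0) / 2 ∈ halfGrid τ T := by simp [halfGrid]

lemma natCast_mem_halfGrid {τ : ℝ} {T t : ℕ} (h₁ : τ ≤ t) (h₂ : (t : ℝ) ≤ T / 2) :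
    (t : ℝ≥0) ∈ halfGrid τ T := by
  have h : (t : ℝ) ≤ T := h₂.trans (half_le_self T.cast_nonneg)
  have h' : t ≤ T := by exact_mod_cast h
  exact Finset.mem_insert_of_mem (Finset.mem_image.2
    ⟨t, by simp only [Finset.mem_filter, Finset.mem_range]; exact ⟨by omega, h₁, h₂⟩, rfl⟩)

lemma le_half_of_mem_halfGrid {τ : ℝ} {T : ℕ} {s : ℝ≥0} (hs : s ∈ halfGrid τ T) :
    s ≤ (T : ℝ≥0) / 2 := by
  simp only [halfGrid, Finset.mem_insert, Finset.mem_image, Finset.mem_filter] at hs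
  rcases hs with rfl | ⟨t, ⟨-, -, h⟩, rfl⟩
  · exact le_rfl
  · exact_mod_cast h

lemma le_of_mem_halfGrid {τ : ℝ} {T : ℕ} (hT : τ ≤ T / 2) {s : ℝ≥0} (hs : s ∈ halfGrid τ T) :
    τ ≤ s := by
  simp only [halfGrid, Finset.mem_insert, Finset.mem_image, Finset.mem_filter] at hs
  rcases hs with rfl | ⟨t, ⟨-, h, -⟩, rfl⟩
  · simpa using hT
  · simpa using h

lemma eventually_le_half {τ : ℕ → ℝ} (hτT : Tendsto (fun T : ℕ ↦ τ T / (T : ℝ)) atTop (𝓝 0)) {c : ℝ}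
    (hc : 0 < c) : ∀ᶠ T : ℕ in atTop, τ T ≤ c * T := by
  filter_upwards [hτT.eventually (gt_mem_nhds hc), eventually_gt_atTop 0] with T h1 h2
  have : (0 : ℝ) < T := by exact_mod_cast h2
  exact ((div_lt_iff₀ this).1 h1).le

/-- The values of a path on `[0, 1]` at the points `τ / s`, `s` in the half grid. -/
noncomputable def gridPath (τ : ℝ) (T : ℕ) (f : ℝ≥0 → ℝ) : halfGrid τ T → ℝ :=
  -- The truncation keeps the argument in `[0,1]` for every `T`; it is inactive once `τ ≤ T/2`.
  fun s ↦ f (min 1 (τ.toNNReal / s))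

/-- The norm of a function on the half grid, with weight `s / T` at `s`. -/
noncomputable def weightedNorm {τ : ℝ} {T : ℕ} (y : halfGrid τ T → ℝ) : ℝ :=
  ‖fun s : halfGrid τ T ↦ ((s : ℝ≥0) / T : ℝ) * y s‖

lemma weightedNorm_nonneg {τ : ℝ} {T : ℕ} (y : halfGrid τ T → ℝ) : 0 ≤ weightedNorm y :=
  norm_nonneg _

/-! ### Limits along a fixed continuous path -/

section Pathwise

variable {f : ℝ≥0 → ℝ} {τ : ℕ → ℝ}

lemma bddAbove_abs_Icc (hf : ContinuousOn f (Set.Icc 0 1)) :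
    BddAbove (Set.range fun u : Set.Icc (0 : ℝ≥0) 1 ↦ |f u|) := by
  have := (isCompact_Icc (a := (0 : ℝ≥0)) (b := 1)).bddAbove_image hf.abs
  rwa [Set.image_eq_range] at this

/-- The maximum of `|f|` over the points `τ / s`, `s` in the half grid, tends to the supremum of
`|f|` over `[0, 1]`. -/
theorem tendsto_norm_gridPath (hf : ContinuousOn f (Set.Icc 0 1)) (hf0 : f 0 = 0)
    (hτ : Tendsto τ atTop atTop) (hτT : Tendsto (fun T : ℕ ↦ τ T / (T : ℝ)) atTop (𝓝 0)) :
    Tendsto (fun T : ℕ ↦ ‖gridPath (τ T) T f‖) atTop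
      (𝓝 (⨆ u : Set.Icc (0 : ℝ≥0) 1, |f u|)) := by
  have hb := bddAbove_abs_Icc hf
  have hup (T : ℕ) : ‖gridPath (τ T) T f‖
      ≤ ⨆ u : Set.Icc (0 : ℝ≥0) 1, |f u| := by
    refine (pi_norm_le_iff_of_nonneg (Real.iSup_nonneg fun _ ↦ abs_nonneg _)).2 fun s ↦ ?_
    exact le_ciSup hb ⟨min 1 ((τ T).toNNReal / s), zero_le, min_le_left _ _⟩
  -- It suffices that one grid point approaches a maximiser `u` of `|f|`. If `u = 0` the supremum is
  -- `0`.
  obtain ⟨u, hu, hmax⟩ := (isCompact_Icc (a := (0 : ℝ≥0)) (b := 1)).exists_isMaxOn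
    ⟨0, by simp⟩ hf.abs
  have hsup : ⨆ u : Set.Icc (0 : ℝ≥0) 1, |f u| = |f u| :=
    le_antisymm (Real.iSup_le (fun v ↦ hmax v.2) (abs_nonneg _)) (le_ciSup hb ⟨u, hu⟩)
  rw [hsup] at hup ⊢
  rcases eq_or_ne u 0 with rfl | hu0
  · simp only [hf0, abs_zero] at hup ⊢
    exact squeeze_zero (fun _ ↦ norm_nonneg _) hup tendsto_const_nhds
  have hupos : (0 : ℝ) < u := NNReal.coe_pos.2 (pos_of_ne_zero hu0)
  have hu1 : (u : ℝ) ≤ 1 := by exact_mod_cast hu.2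
  -- the grid point `τ / ⌈τ / u⌉` is close to `u`
  have hlim : Tendsto (fun T : ℕ ↦ τ T / (⌈τ T / u⌉₊ : ℝ)) atTop (𝓝 (u : ℝ)) := by
    have h1 : Tendsto (fun T : ℕ ↦ (⌈(u : ℝ)⁻¹ * τ T⌉₊ : ℝ) / τ T) atTop (𝓝 (u : ℝ)⁻¹) :=
      (tendsto_nat_ceil_mul_div_atTop (inv_pos.2 hupos).le).comp hτ
    have h2 := h1.inv₀ (inv_pos.2 hupos).ne'
    rw [inv_inv] at h2
    refine h2.congr fun T ↦ ?_
    rw [inv_div, div_eq_inv_mul]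
    ring_nf
  have hlim' : Tendsto (fun T : ℕ ↦ min 1 ((τ T).toNNReal / (⌈τ T / u⌉₊ : ℝ≥0))) atTop
      (𝓝 u) := by
    have h := (tendsto_const_nhds (x := (1 : ℝ≥0))).min ((continuous_real_toNNReal.tendsto _).comp hlim)
    rw [Real.toNNReal_coe, min_eq_right hu.2] at h
    refine h.congr' ?_
    filter_upwards [hτ.eventually_ge_atTop 0] with T hT
    simp [Real.toNNReal_div hT]
  have hfl : Tendsto (fun T : ℕ ↦ |f (min 1 ((τ T).toNNReal / (⌈τ T / u⌉₊ : ℝ≥0)))|) atTop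
      (𝓝 |f u|) := by
    refine (hf.abs u hu).tendsto.comp (tendsto_nhdsWithin_iff.2 ⟨hlim', ?_⟩)
    exact Eventually.of_forall fun T ↦ ⟨zero_le, min_le_left _ _⟩
  refine tendsto_of_tendsto_of_tendsto_of_le_of_le' hfl tendsto_const_nhds ?_
    (Eventually.of_forall hup)
  -- From `τ ≤ (u/4) T` and `T ≥ 4` follows `⌈τ/u⌉ ≤ T/4 + 1 ≤ T/2`, so this integer is in the grid.
  filter_upwards [hτ.eventually_ge_atTop 0, eventually_le_half hτT
    (show (0 : ℝ) < u / 4 by positivity), eventually_ge_atTop 4] with T hT0 hT1 hT2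
  have hT2' : (4 : ℝ) ≤ T := by exact_mod_cast hT2
  have hm : ((⌈τ T / u⌉₊ : ℕ) : ℝ≥0) ∈ halfGrid (τ T) T := by
    apply natCast_mem_halfGrid
    · refine le_trans ?_ (Nat.le_ceil _)
      rw [le_div_iff₀ hupos]
      nlinarith
    · have := (Nat.ceil_lt_add_one (show 0 ≤ τ T / u by positivity)).le
      have h3 : τ T / u ≤ T / 4 := by
        rw [div_le_iff₀ hupos]; linarith
      linarith
  exact norm_le_pi_norm (gridPath (τ T) T f) ⟨_, hm⟩

/-- At each grid point one of two factors is small. If `τ/s` is near `0`, so is `f`, by continuity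
and `f 0 = 0`. Otherwise `s` is at most a constant times `τ`, and the weight `s/T` is small while
`f` is bounded. -/
theorem tendsto_weightedNorm_gridPath (hf : ContinuousOn f (Set.Icc 0 1)) (hf0 : f 0 = 0)
    (hτT : Tendsto (fun T : ℕ ↦ τ T / (T : ℝ)) atTop (𝓝 0)) :
    Tendsto (fun T : ℕ ↦ weightedNorm (gridPath (τ T) T f)) atTop (𝓝 0) := by
  obtain ⟨C, hC⟩ := bddAbove_abs_Icc hf
  have hC' : ∀ v ≤ 1, |f v| ≤ C := fun v hv ↦ hC ⟨⟨v, zero_le, hv⟩, rfl⟩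
  have hC0 : 0 ≤ C := (abs_nonneg _).trans (hC' 0 zero_le)
  rw [Metric.tendsto_nhds]
  intro ε hε
  have h0 := Metric.continuousWithinAt_iff.1 (hf 0 (by simp)) ε hε
  obtain ⟨δ, hδ, h0⟩ := h0
  have hc : 0 < δ * (ε / (2 * (C + 1))) := by positivity
  filter_upwards [eventually_le_half hτT hc, eventually_gt_atTop 0] with T hT hTpos
  have hTpos' : (0 : ℝ) < T := by exact_mod_cast hTpos
  rw [dist_zero_right, Real.norm_of_nonneg (weightedNorm_nonneg _)]
  refine lt_of_le_of_lt ((pi_norm_le_iff_of_nonneg (half_pos hε).le).2 fun s ↦ ?_) (half_lt_self hε)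
  have hs : ((s : ℝ≥0) : ℝ) ≤ T / 2 := by exact_mod_cast le_half_of_mem_halfGrid s.2
  rw [norm_mul, Real.norm_eq_abs, Real.norm_eq_abs, abs_of_nonneg (by positivity), gridPath]
  set u : ℝ≥0 := min 1 ((τ T).toNNReal / s) with hu
  have hu1 : u ≤ 1 := min_le_left _ _
  rcases lt_or_ge (u : ℝ) δ with hlt | hge
  · have h1 : |f u| < ε := by
      have := h0 (x := u) ⟨zero_le, hu1⟩ (by simpa [NNReal.dist_eq] using hlt)
      simpa [hf0] using this
    have h2 : ((s : ℝ≥0) : ℝ) / T ≤ 1 / 2 := by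
      rw [div_le_iff₀ hTpos']; linarith
    calc ((s : ℝ≥0) : ℝ) / T * |f u| ≤ 1 / 2 * ε := by gcongr
      _ = ε / 2 := by ring
  · have hus : δ ≤ ((τ T).toNNReal : ℝ) / ((s : ℝ≥0) : ℝ) := by
      refine hge.trans ?_
      exact_mod_cast (min_le_right _ _ : u ≤ _)
    have hspos : (0 : ℝ) < ((s : ℝ≥0) : ℝ) := by
      rcases eq_or_lt_of_le (NNReal.coe_nonneg (s : ℝ≥0)) with h | h
      · rw [← h, div_zero] at hus; linarith
      · exact h
    have hτs : δ * ((s : ℝ≥0) : ℝ) ≤ δ * (ε / (2 * (C + 1))) * T := by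
      rw [le_div_iff₀ hspos, Real.coe_toNNReal'] at hus
      exact hus.trans (max_le hT (by positivity))
    have hsT : ((s : ℝ≥0) : ℝ) / T ≤ ε / (2 * (C + 1)) := by
      rw [div_le_iff₀ hTpos']
      rw [mul_assoc] at hτs
      exact le_of_mul_le_mul_left hτs hδ
    calc ((s : ℝ≥0) : ℝ) / T * |f u| ≤ ε / (2 * (C + 1)) * (C + 1) := by
          gcongr; linarith [hC' u hu1]
      _ = ε / 2 := by field_simp

end Pathwise

/-! ### Deterministic estimates for the Rényi statistic -/

lemma Finset.sum_Icc_add_sum_Icc {M : Type*} [AddCommMonoid M] (x : ℕ → M) {t T : ℕ} (h : t ≤ T) :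
    ∑ s ∈ Finset.Icc 1 t, x s + ∑ s ∈ Finset.Icc (t + 1) T, x s = ∑ s ∈ Finset.Icc 1 T, x s := by
  have h1 (a b : ℕ) : Finset.Icc (a + 1) b = Finset.Ioc a b := by ext; simp
  rw [h1 t T, show Finset.Icc 1 t = Finset.Ioc 0 t from h1 0 t,
    show Finset.Icc 1 T = Finset.Ioc 0 T from h1 0 T]
  exact Finset.sum_Ioc_consecutive x (Nat.zero_le _) h

lemma sampleMeanDiff_const_add (x : ℕ → ℝ) (c : ℝ) {T t : ℕ} (ht : 0 < t) (htT : t < T) :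
    sampleMeanDiff (fun s ↦ c + x s) T t = sampleMeanDiff x T t := by
  have h1 : (t : ℝ) ≠ 0 := by positivity
  have h2 : (T : ℝ) - t ≠ 0 := by
    have : (t : ℝ) < T := by exact_mod_cast htT
    linarith
  simp only [sampleMeanDiff, Finset.sum_add_distrib, Finset.sum_const, Nat.card_Icc, nsmul_eq_mul]
  have h3 : ((T + 1 - (t + 1) : ℕ) : ℝ) = T - t := by
    rw [Nat.add_sub_add_right, Nat.cast_sub htT.le]
  rw [h3, Nat.add_sub_cancel]
  field_simp
  ring

/-- Positivity of `τ` forces `0 < t < T`. At `t = 0` or `t = T` division by zero would make one of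
the means `0`, and the constant would not cancel. -/
lemma renyiStat_const_add {x y : ℕ → ℝ} {c : ℝ} (hxy : ∀ s, 1 ≤ s → y s = c + x s) {τ : ℝ}
    (hτ : 0 < τ) (T : ℕ) : renyiStat y τ T = renyiStat x τ T := by
  unfold renyiStat
  congr 1
  refine Finset.sup_congr rfl fun t ht ↦ ?_
  simp only [Finset.mem_filter] at ht
  have h1 : 0 < t := by
    have : (0 : ℝ) < t := hτ.trans_le ht.2.1
    exact_mod_cast this
  have h2 : t < T := by
    have : (t : ℝ) < T := by linarith
    exact_mod_cast this
  rw [← sampleMeanDiff_const_add x c h1 h2]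
  congr 1
  unfold sampleMeanDiff
  congr 2
  · exact Finset.sum_congr rfl fun s hs ↦ hxy s (Finset.mem_Icc.1 hs).1
  · exact Finset.sum_congr rfl fun s hs ↦ hxy s (by have := (Finset.mem_Icc.1 hs).1; omega)

lemma abs_sampleMeanDiff_le_renyiStat (x : ℕ → ℝ) {τ : ℝ} {T t : ℕ} (hτ : 0 ≤ τ) (h1 : τ ≤ t)
    (h2 : (t : ℝ) ≤ T - τ) : |sampleMeanDiff x T t| ≤ renyiStat x τ T := by
  have htT : t ≤ T := by
    have : (t : ℝ) ≤ T := by linarith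
    exact_mod_cast this
  have hm : t ∈ (Finset.range (T + 1)).filter fun t : ℕ ↦ τ ≤ (t : ℝ) ∧ (t : ℝ) ≤ (T : ℝ) - τ := by
    simp only [Finset.mem_filter, Finset.mem_range]
    exact ⟨by omega, h1, h2⟩
  exact NNReal.coe_le_coe.2 (Finset.le_sup (f := fun t ↦ ‖sampleMeanDiff x T t‖₊) hm)

lemma renyiStat_le (x : ℕ → ℝ) {τ : ℝ} {T : ℕ} {c : ℝ} (hc : 0 ≤ c)
    (h : ∀ t : ℕ, τ ≤ t → (t : ℝ) ≤ T - τ → |sampleMeanDiff x T t| ≤ c) : renyiStat x τ T ≤ c := by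
  lift c to ℝ≥0 using hc
  refine NNReal.coe_le_coe.2 (Finset.sup_le fun t ht ↦ ?_)
  simp only [Finset.mem_filter] at ht
  exact NNReal.coe_le_coe.1 (h t ht.2.1 ht.2.2)

/-- Approximation of one difference of sample means: `A`, `A'` and `B` stand for the sums of the
first `k`, the first `T / 2` and the last `T / 2` terms. -/
lemma abs_meanDiff_sub_le {T k σ p D A A' B w w' v : ℝ} (hk0 : 0 < k) (hk : k ≤ T / 2)
    (hσ : 0 < σ) (hp : 0 ≤ p) (hD : 0 ≤ D) (hA : |A - σ * w| ≤ D * k)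
    (hA' : |A' - σ * w'| ≤ D * (T / 2)) (hB : |B - σ * v| ≤ D * (T / 2)) :
    |p / σ * |A / k - (A' - A + B) / (T - k)| - (|p / k * w|)| ≤
      2 * (p / T * |w| + p / T * |w'| + p / T * |v|) + 4 * (p * D / σ) := by
  have hT : 0 < T := by linarith
  have hTk : 0 < T - k := by linarith
  have e1 : |p / k * w| = p / σ * |σ * w / k| := by
    rw [abs_mul, abs_div, abs_div (σ * w), abs_mul σ, abs_of_nonneg hp, abs_of_pos hk0, abs_of_pos hσ]
    field_simp
  have b1 : |A / k - σ * w / k| ≤ D := by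
    rw [← sub_div, abs_div, abs_of_pos hk0, div_le_iff₀ hk0]
    exact hA
  -- The terms after the `k`-th are the rest of the first half plus the second half, so three
  -- approximation errors enter.
  have b2 : |A' - A + B| ≤ σ * (|w| + |w'| + |v|) + 3 * D * (T / 2) := by
    have t1 : A' - A + B = (A' - σ * w') - (A - σ * w) + (B - σ * v) + σ * (w' - w + v) := by ring
    have t2 : |σ * (w' - w + v)| ≤ σ * (|w| + |w'| + |v|) := by
      rw [abs_mul, abs_of_pos hσ]
      gcongr
      have := abs_add_le (w' - w) v
      have := abs_sub w' w
      linarith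
    rw [t1]
    have := abs_add_le ((A' - σ * w') - (A - σ * w) + (B - σ * v)) (σ * (w' - w + v))
    have := abs_add_le ((A' - σ * w') - (A - σ * w)) (B - σ * v)
    have := abs_sub (A' - σ * w') (A - σ * w)
    have : D * k ≤ D * (T / 2) := by gcongr
    linarith
  have b3 : |(A' - A + B) / (T - k)| ≤ (σ * (|w| + |w'| + |v|) + 3 * D * (T / 2)) / (T / 2) := by
    rw [abs_div, abs_of_pos hTk]
    gcongr
    linarith
  rw [e1, ← mul_sub, abs_mul, abs_of_nonneg (div_nonneg hp hσ.le)]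
  calc p / σ * |(|A / k - (A' - A + B) / (T - k)| - |σ * w / k|)|
      ≤ p / σ * (D + (σ * (|w| + |w'| + |v|) + 3 * D * (T / 2)) / (T / 2)) := by
        gcongr
        refine (abs_abs_sub_abs_le _ _).trans ?_
        rw [show A / k - (A' - A + B) / (T - k) - σ * w / k
          = (A / k - σ * w / k) - (A' - A + B) / (T - k) by ring]
        exact (abs_sub _ _).trans (add_le_add b1 b3)
    _ = 2 * (p / T * |w| + p / T * |w'| + p / T * |v|) + 4 * (p * D / σ) := by
        field_simp
        ring

/-- Since `κ ≤ 1`, the power `x^(κ-1)` is largest at `x = τ`. This turns the `x^κ` error into one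
linear in `x`, ready to be divided by the sample length. -/
lemma abs_sub_le_mul_of_rpow {x τ κ M z : ℝ} (hτ : 1 ≤ τ) (hx : τ ≤ x) (hκ : κ ≤ 1) (hM : 0 ≤ M)
    (h : x ^ (-κ) * |z| ≤ M) : |z| ≤ M * τ ^ (κ - 1) * x := by
  have hx0 : 0 < x := by linarith
  have h1 : x ^ κ * x ^ (-κ) = 1 := by rw [← Real.rpow_add hx0]; simp
  have h2 : |z| ≤ x ^ κ * M := by
    calc |z| = x ^ κ * (x ^ (-κ) * |z|) := by rw [← mul_assoc, h1, one_mul]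
      _ ≤ x ^ κ * M := by gcongr
  have h3 : x ^ κ = x ^ (κ - 1) * x := by
    rw [Real.rpow_sub_one hx0.ne']; field_simp
  have h4 : x ^ (κ - 1) ≤ τ ^ (κ - 1) :=
    Real.rpow_le_rpow_of_nonpos (by linarith) hx (by linarith)
  calc |z| ≤ x ^ (κ - 1) * x * M := by rwa [← h3]
    _ ≤ τ ^ (κ - 1) * x * M := by gcongr
    _ = _ := by ring

/-! ### Comparison of the statistic with the scaled paths -/

/-- The path `s ↦ τ^{1/2} w(s) / s` on the half grid. -/
noncomputable def scaledPath (τ : ℝ) (T : ℕ) (w : ℝ≥0 → ℝ) : halfGrid τ T → ℝ :=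
  fun s ↦ Real.sqrt τ.toNNReal / ((s : ℝ≥0) : ℝ) * w s

/-- The weight `s/T` cancels the `1/s` of the scaled path. This is the form in which the mean over
the longer segment is bounded. -/
lemma le_weightedNorm_scaledPath {τ : ℝ} {T : ℕ} (hτ : 0 < τ) (hT : τ ≤ T / 2) (w : ℝ≥0 → ℝ)
    {s : ℝ≥0} (hs : s ∈ halfGrid τ T) :
    Real.sqrt τ / T * |w s| ≤ weightedNorm (scaledPath τ T w) := by
  have hs0 : (0 : ℝ) < s := hτ.trans_le (le_of_mem_halfGrid hT hs)
  have hT0 : (0 : ℝ) < T := by linarith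
  refine le_trans (le_of_eq ?_) (norm_le_pi_norm _ (⟨s, hs⟩ : halfGrid τ T))
  simp only [scaledPath, norm_mul, Real.norm_eq_abs, abs_div, NNReal.abs_eq,
    Real.coe_toNNReal _ hτ.le, abs_of_nonneg (Real.sqrt_nonneg _), Nat.abs_cast]
  field_simp

lemma abs_mul_half_le_weightedNorm {τ : ℝ} {T : ℕ} (hτ : 0 < τ) (hT : τ ≤ T / 2) (w : ℝ≥0 → ℝ) :
    |Real.sqrt τ / (((T : ℝ≥0) / 2 : ℝ≥0) : ℝ) * w ((T : ℝ≥0) / 2)|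
      ≤ 2 * weightedNorm (scaledPath τ T w) := by
  have h := le_weightedNorm_scaledPath hτ hT w (half_mem_halfGrid τ T)
  have h' : |Real.sqrt τ / (((T : ℝ≥0) / 2 : ℝ≥0) : ℝ) * w ((T : ℝ≥0) / 2)|
      = 2 * (Real.sqrt τ / T * |w ((T : ℝ≥0) / 2)|) := by
    rw [abs_mul, abs_of_nonneg (by positivity), NNReal.coe_div, NNReal.coe_natCast,
      NNReal.coe_ofNat, div_div_eq_mul_div]
    ring
  rw [h']
  linarith

/-- Passage from the individual differences of sample means to the Rényi statistic. -/
lemma abs_renyiStat_sub_max_le {e : ℕ → ℝ} {w₁ w₂ : ℝ≥0 → ℝ} {T : ℕ} {τ σ E : ℝ} (hτ0 : 0 < τ)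
    (hT : τ ≤ T / 2) (hσ : 0 < σ) (hE0 : 0 ≤ E)
    (left : ∀ t : ℕ, τ ≤ t → (t : ℝ) ≤ T / 2 →
      |Real.sqrt τ / σ * |sampleMeanDiff e T t| - (|Real.sqrt τ / t * w₁ t|)| ≤ E)
    (right : ∀ k : ℕ, τ ≤ k → (k : ℝ) ≤ T / 2 →
      |Real.sqrt τ / σ * |sampleMeanDiff e T (T - k)| - (|Real.sqrt τ / k * w₂ k|)| ≤ E)
    (h₁ : 2 * weightedNorm (scaledPath τ T w₁) ≤ E)
    (h₂ : 2 * weightedNorm (scaledPath τ T w₂) ≤ E) :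
    |Real.sqrt τ * (renyiStat e τ T / σ) -
      max ‖scaledPath τ T w₁‖ ‖scaledPath τ T w₂‖| ≤ E := by
  have hmid₁ := abs_mul_half_le_weightedNorm hτ0 hT w₁
  have hmid₂ := abs_mul_half_le_weightedNorm hτ0 hT w₂
  have hval (w : ℝ≥0 → ℝ) (s : halfGrid τ T) :
      ‖scaledPath τ T w s‖ = |Real.sqrt τ / ((s : ℝ≥0) : ℝ) * w s| := by
    simp only [scaledPath, Real.norm_eq_abs, Real.coe_toNNReal _ hτ0.le]
  have hp0 : 0 < Real.sqrt τ := Real.sqrt_pos.2 hτ0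
  generalize Real.sqrt τ = p at *
  have hcases {s : ℝ≥0} (hs : s ∈ halfGrid τ T) :
      s = (T : ℝ≥0) / 2 ∨ ∃ t : ℕ, τ ≤ t ∧ (t : ℝ) ≤ T / 2 ∧ (t : ℝ≥0) = s := by
    simp only [halfGrid, Finset.mem_insert, Finset.mem_image, Finset.mem_filter] at hs
    rcases hs with h | ⟨t, ⟨-, h, h'⟩, h''⟩
    · exact Or.inl h
    · exact Or.inr ⟨t, h, h', h''⟩
  have hZ (t : ℕ) (h : τ ≤ t) (h' : (t : ℝ) ≤ T - τ) :
      p / σ * |sampleMeanDiff e T t| ≤ p * (renyiStat e τ T / σ) := by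
    calc p / σ * |sampleMeanDiff e T t| ≤ p / σ * renyiStat e τ T := by
          gcongr
          exact abs_sampleMeanDiff_le_renyiStat e hτ0.le h h'
      _ = _ := by ring
  have hZ0 : 0 ≤ p * (renyiStat e τ T / σ) :=
    mul_nonneg hp0.le (div_nonneg (NNReal.coe_nonneg _) hσ.le)
  rw [abs_le]
  constructor
  · have c₁ : ‖scaledPath τ T w₁‖ ≤ p * (renyiStat e τ T / σ) + E := by
      refine (pi_norm_le_iff_of_nonneg (by positivity)).2 fun s ↦ ?_
      rw [hval]
      -- The point `T/2` need not be an integer, so it need not be an index of the statistic; its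
      -- contribution is absorbed into `E`.
      rcases hcases s.2 with h | ⟨t, ht, htT, h⟩
      · have := hmid₁
        rw [h]
        linarith
      · rw [← h]
        have h3 := (abs_le.1 (left t ht htT)).1
        have h4 := hZ t ht (by linarith)
        rw [NNReal.coe_natCast]
        linarith
    have c₂ : ‖scaledPath τ T w₂‖ ≤ p * (renyiStat e τ T / σ) + E := by
      refine (pi_norm_le_iff_of_nonneg (by positivity)).2 fun s ↦ ?_
      rw [hval]
      rcases hcases s.2 with h | ⟨t, ht, htT, h⟩
      · have := hmid₂
        rw [h]
        linarith
      · rw [← h]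
        have hle : t ≤ T := by
          have h : (t : ℝ) ≤ T := by linarith
          exact_mod_cast h
        have h3 := (abs_le.1 (right t ht htT)).1
        have h4 := hZ (T - t) (by rw [Nat.cast_sub hle]; linarith)
          (by rw [Nat.cast_sub hle]; linarith)
        rw [NNReal.coe_natCast]
        linarith
    have := max_le c₁ c₂
    linarith
  · have hmax0 : 0 ≤ max ‖scaledPath τ T w₁‖ ‖scaledPath τ T w₂‖ := le_max_of_le_left (norm_nonneg _)
    have hle : renyiStat e τ T ≤ (max ‖scaledPath τ T w₁‖ ‖scaledPath τ T w₂‖ + E) / (p / σ) := by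
      refine renyiStat_le e (by positivity) fun t ht htT ↦ ?_
      rw [le_div_iff₀ (by positivity), mul_comm]
      rcases le_total (t : ℝ) (T / 2) with h | h
      · have h3 := (abs_le.1 (left t ht h)).2
        have h4 := norm_le_pi_norm (scaledPath τ T w₁) ⟨_, natCast_mem_halfGrid ht h⟩
        rw [hval, NNReal.coe_natCast] at h4
        have := le_max_left ‖scaledPath τ T w₁‖ ‖scaledPath τ T w₂‖
        linarith
      · have hle : t ≤ T := by
          have h : (t : ℝ) ≤ T := by linarith
          exact_mod_cast h
        have hc : ((T - t : ℕ) : ℝ) = T - t := Nat.cast_sub hle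
        have k1 : τ ≤ ((T - t : ℕ) : ℝ) := by rw [hc]; linarith
        have k2 : ((T - t : ℕ) : ℝ) ≤ T / 2 := by rw [hc]; linarith
        have h3 := (abs_le.1 (right (T - t) k1 k2)).2
        rw [Nat.sub_sub_self hle] at h3
        have h4 := norm_le_pi_norm (scaledPath τ T w₂) ⟨_, natCast_mem_halfGrid k1 k2⟩
        rw [hval, NNReal.coe_natCast] at h4
        have := le_max_right ‖scaledPath τ T w₁‖ ‖scaledPath τ T w₂‖
        linarith
    rw [le_div_iff₀ (by positivity)] at hle
    have : p * (renyiStat e τ T / σ) = renyiStat e τ T * (p / σ) := by ring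
    linarith

/-- On the event where the Gaussian approximation errors are at most `M`, the normalized Rényi
statistic is close to the maximum of the two scaled paths. -/
theorem abs_renyiStat_sub_le {e : ℕ → ℝ} {w₁ w₂ : ℝ≥0 → ℝ} {T : ℕ} {τ σ κ M : ℝ} (hτ : 1 ≤ τ)
    (hT : τ ≤ T / 2) (hσ : 0 < σ) (hκ : κ ≤ 1) (hM : 0 ≤ M)
    (h₁ : ∀ x ∈ Set.Icc (1 : ℝ) ((T : ℝ) / 2),
      x ^ (-κ) * |∑ s ∈ Finset.Icc 1 ⌊x⌋₊, e s - σ * w₁ x.toNNReal| ≤ M)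
    (h₂ : ∀ x ∈ Set.Icc ((T : ℝ) / 2) ((T : ℝ) - 1),
      ((T : ℝ) - x) ^ (-κ) *
        |∑ s ∈ Finset.Icc (⌊x⌋₊ + 1) T, e s - σ * w₂ ((T : ℝ) - x).toNNReal| ≤ M) :
    |Real.sqrt τ * (renyiStat e τ T / σ) -
        max ‖scaledPath τ T w₁‖ ‖scaledPath τ T w₂‖| ≤
      4 * (weightedNorm (scaledPath τ T w₁) + weightedNorm (scaledPath τ T w₂))
        + 4 * (Real.sqrt τ * (M * τ ^ (κ - 1)) / σ) := by
  have hτ0 : 0 < τ := by linarith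
  have hT0 : (0 : ℝ) < T := by linarith
  set p := Real.sqrt τ with hp
  have hp0 : 0 < p := Real.sqrt_pos.2 hτ0
  set D := M * τ ^ (κ - 1) with hD
  have hD0 : 0 ≤ D := by positivity
  set g₁ := weightedNorm (scaledPath τ T w₁) with hg₁
  set g₂ := weightedNorm (scaledPath τ T w₂) with hg₂
  have hg₁0 : 0 ≤ g₁ := weightedNorm_nonneg _
  have hg₂0 : 0 ≤ g₂ := weightedNorm_nonneg _
  set E := 4 * (g₁ + g₂) + 4 * (p * D / σ) with hE
  have hE0 : 0 ≤ E := by positivity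
  have hpD : 0 ≤ p * D / σ := by positivity
  set N := ⌊(T : ℝ) / 2⌋₊ with hN
  have hNT : N ≤ T := by
    have h : (N : ℝ) ≤ T := (Nat.floor_le (by positivity)).trans (by linarith)
    exact_mod_cast h
  have hhalf : ((T : ℝ) / 2).toNNReal = (T : ℝ≥0) / 2 := by
    rw [Real.toNNReal_div T.cast_nonneg]; simp
  -- Evaluated at `x = T/2`, both approximations split the sum at the same `N`, so no term is lost
  -- when `T` is odd.
  have hH₁ : |∑ s ∈ Finset.Icc 1 N, e s - σ * w₁ ((T : ℝ≥0) / 2)| ≤ D * ((T : ℝ) / 2) := by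
    have := abs_sub_le_mul_of_rpow hτ hT hκ hM (h₁ _ ⟨hτ.trans hT, le_rfl⟩)
    rwa [hhalf] at this
  have hH₂ : |∑ s ∈ Finset.Icc (N + 1) T, e s - σ * w₂ ((T : ℝ≥0) / 2)| ≤ D * ((T : ℝ) / 2) := by
    have hx : (T : ℝ) - T / 2 = T / 2 := by ring
    have h := h₂ _ ⟨le_rfl, by linarith⟩
    rw [hx] at h
    have := abs_sub_le_mul_of_rpow hτ hT hκ hM h
    rwa [hhalf] at this
  have hw₁ {s : ℝ≥0} (hs : s ∈ halfGrid τ T) := le_weightedNorm_scaledPath hτ0 hT w₁ hs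
  have hw₂ {s : ℝ≥0} (hs : s ∈ halfGrid τ T) := le_weightedNorm_scaledPath hτ0 hT w₂ hs
  have hmid := half_mem_halfGrid τ T
  -- the left half
  have left (t : ℕ) (ht : τ ≤ t) (htT : (t : ℝ) ≤ T / 2) :
      |p / σ * |sampleMeanDiff e T t| - (|p / t * w₁ t|)| ≤ E := by
    have hle : t ≤ T := by
      have h : (t : ℝ) ≤ T := by linarith
      exact_mod_cast h
    have hA : |∑ s ∈ Finset.Icc 1 t, e s - σ * w₁ t| ≤ D * t := by
      have := abs_sub_le_mul_of_rpow hτ ht hκ hM (h₁ t ⟨hτ.trans ht, htT⟩)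
      simpa using this
    have hsum := Finset.sum_Icc_add_sum_Icc e hle
    have hsum' := Finset.sum_Icc_add_sum_Icc e hNT
    have key := abs_meanDiff_sub_le (by linarith) htT hσ hp0.le hD0 hA hH₁ hH₂
    have heq : sampleMeanDiff e T t = (∑ s ∈ Finset.Icc 1 t, e s) / t -
        (∑ s ∈ Finset.Icc 1 N, e s - ∑ s ∈ Finset.Icc 1 t, e s + ∑ s ∈ Finset.Icc (N + 1) T, e s)
          / (T - t) := by
      unfold sampleMeanDiff
      rw [show ∑ s ∈ Finset.Icc 1 N, e s - ∑ s ∈ Finset.Icc 1 t, e s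
        + ∑ s ∈ Finset.Icc (N + 1) T, e s = ∑ s ∈ Finset.Icc (t + 1) T, e s by linarith]
      ring
    rw [← heq] at key
    refine key.trans ?_
    have := hw₁ (natCast_mem_halfGrid ht htT)
    have := hw₁ hmid
    have := hw₂ hmid
    linarith
  -- the right half
  have right (k : ℕ) (hk : τ ≤ k) (hkT : (k : ℝ) ≤ T / 2) :
      |p / σ * |sampleMeanDiff e T (T - k)| - (|p / k * w₂ k|)| ≤ E := by
    have hle : k ≤ T := by
      have h : (k : ℝ) ≤ T := by linarith
      exact_mod_cast h
    have hcast : ((T - k : ℕ) : ℝ) = T - k := Nat.cast_sub hle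
    have hA : |∑ s ∈ Finset.Icc (T - k + 1) T, e s - σ * w₂ k| ≤ D * k := by
      have h := h₂ ((T - k : ℕ) : ℝ) ⟨by rw [hcast]; linarith, by rw [hcast]; linarith⟩
      rw [Nat.floor_natCast, hcast, sub_sub_cancel, Real.toNNReal_natCast] at h
      exact abs_sub_le_mul_of_rpow hτ hk hκ hM h
    have hsum := Finset.sum_Icc_add_sum_Icc e (Nat.sub_le T k)
    have hsum' := Finset.sum_Icc_add_sum_Icc e hNT
    -- Reflection: the last `k` terms play the part of the first `k`, and the two halves are
    -- exchanged.
    have key := abs_meanDiff_sub_le (by linarith) hkT hσ hp0.le hD0 hA hH₂ hH₁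
    have heq : |sampleMeanDiff e T (T - k)| = |(∑ s ∈ Finset.Icc (T - k + 1) T, e s) / k -
        (∑ s ∈ Finset.Icc (N + 1) T, e s - ∑ s ∈ Finset.Icc (T - k + 1) T, e s
          + ∑ s ∈ Finset.Icc 1 N, e s) / (T - k)| := by
      unfold sampleMeanDiff
      rw [show ∑ s ∈ Finset.Icc (N + 1) T, e s - ∑ s ∈ Finset.Icc (T - k + 1) T, e s
        + ∑ s ∈ Finset.Icc 1 N, e s = ∑ s ∈ Finset.Icc 1 (T - k), e s by linarith, hcast,
        sub_sub_cancel, abs_sub_comm]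
      ring_nf
    rw [← heq] at key
    refine key.trans ?_
    have := hw₂ (natCast_mem_halfGrid hk hkT)
    have := hw₁ hmid
    have := hw₂ hmid
    linarith
  exact abs_renyiStat_sub_max_le hτ0 hT hσ hE0 left right (by linarith) (by linarith)

/-! ### Measurability and transfer of laws and independence -/

/-- Convergence in distribution only depends on the laws, and only on those of all but finitely
many variables of the sequence. -/
theorem tendstoInDistribution_of_eventually_identDistrib {ι Ω Ω' Ω₁ Ω₁' E : Type*}
    [MeasurableSpace Ω] [MeasurableSpace Ω'] [MeasurableSpace Ω₁] [MeasurableSpace Ω₁']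
    [TopologicalSpace E] [MeasurableSpace E] [OpensMeasurableSpace E] {μ : Measure Ω}
    [IsProbabilityMeasure μ] {μ' : Measure Ω'} [IsProbabilityMeasure μ'] {ν : Measure Ω₁}
    [IsProbabilityMeasure ν] {ν' : Measure Ω₁'} [IsProbabilityMeasure ν'] {l : Filter ι}
    {X : ι → Ω → E} {Y : ι → Ω' → E} {Z : Ω₁ → E} {Z' : Ω₁' → E}
    (h : TendstoInDistribution X l Z (fun _ ↦ μ) ν) (hY : ∀ i, AEMeasurable (Y i) μ')
    (hXY : ∀ᶠ i in l, IdentDistrib (Y i) (X i) μ' μ) (hZ : IdentDistrib Z' Z ν' ν) :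
    TendstoInDistribution Y l Z' (fun _ ↦ μ') ν' where
  forall_aemeasurable := hY
  aemeasurable_limit := hZ.aemeasurable_fst
  tendsto := by
    have h0 := h.tendsto
    have e : (⟨ν'.map Z', Measure.isProbabilityMeasure_map hZ.aemeasurable_fst⟩ :
        ProbabilityMeasure E) = ⟨ν.map Z, Measure.isProbabilityMeasure_map h.aemeasurable_limit⟩ :=
      Subtype.ext hZ.map_eq
    rw [e]
    refine h0.congr' ?_
    filter_upwards [hXY] with i hi
    exact Subtype.ext hi.map_eq.symm

lemma aemeasurable_renyiStat {Ω : Type*} [MeasurableSpace Ω] {P : Measure Ω} {X : ℕ → Ω → ℝ}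
    (hX : ∀ t, 1 ≤ t → AEMeasurable (X t) P) (τ : ℝ) (T : ℕ) :
    AEMeasurable (fun ω ↦ renyiStat (fun s ↦ X s ω) τ T) P := by
  have hm (t : ℕ) : AEMeasurable (fun ω ↦ ‖sampleMeanDiff (fun s ↦ X s ω) T t‖₊) P := by
    unfold sampleMeanDiff
    refine AEMeasurable.nnnorm (AEMeasurable.sub (AEMeasurable.const_mul ?_ _)
      (AEMeasurable.const_mul ?_ _))
    · exact Finset.aemeasurable_fun_sum _ fun s hs ↦ hX s (Finset.mem_Icc.1 hs).1
    · exact Finset.aemeasurable_fun_sum _ fun s hs ↦ hX s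
        (by have := (Finset.mem_Icc.1 hs).1; omega)
  unfold renyiStat
  refine AEMeasurable.coe_nnreal_real ?_
  induction ((Finset.range (T + 1)).filter fun t : ℕ ↦
    τ ≤ (t : ℝ) ∧ (t : ℝ) ≤ (T : ℝ) - τ) using Finset.induction_on with
  | empty => simp only [Finset.sup_empty]; exact aemeasurable_const
  | insert a s _ ih => simp only [Finset.sup_insert]; exact (hm a).sup ih

lemma measurable_weightedNorm {τ : ℝ} {T : ℕ} :
    Measurable (weightedNorm : (halfGrid τ T → ℝ) → ℝ) := by
  unfold weightedNorm
  refine Continuous.measurable ?_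
  fun_prop

lemma forall_le_of_forwardError_le {Ω : Type*} [MeasurableSpace Ω] {e : ℕ → Ω → ℝ} {σ κ : ℝ}
    {W : ℝ≥0 → Ω → ℝ} {T : ℕ} {ω : Ω} {M : ℝ≥0} (h : forwardError e σ κ W T ω ≤ M) :
    ∀ x ∈ Set.Icc (1 : ℝ) ((T : ℝ) / 2),
      x ^ (-κ) * |∑ s ∈ Finset.Icc 1 ⌊x⌋₊, e s ω - σ * W x.toNNReal ω| ≤ M :=
  fun x hx ↦ ENNReal.ofReal_le_coe.1 ((iSup₂_le_iff.1 h) x hx)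

lemma forall_le_of_backwardError_le {Ω : Type*} [MeasurableSpace Ω] {e : ℕ → Ω → ℝ} {σ κ : ℝ}
    {W : ℝ≥0 → Ω → ℝ} {T : ℕ} {ω : Ω} {M : ℝ≥0} (h : backwardError e σ κ W T ω ≤ M) :
    ∀ x ∈ Set.Icc ((T : ℝ) / 2) ((T : ℝ) - 1), ((T : ℝ) - x) ^ (-κ) *
      |∑ s ∈ Finset.Icc (⌊x⌋₊ + 1) T, e s ω - σ * W ((T : ℝ) - x).toNNReal ω| ≤ M :=
  fun x hx ↦ ENNReal.ofReal_le_coe.1 ((iSup₂_le_iff.1 h) x hx)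

lemma IsWienerOn.aemeasurable_gridPath {Ω : Type*} [MeasurableSpace Ω] {P : Measure Ω}
    {W : ℝ≥0 → Ω → ℝ} (hW : IsWienerOn 1 W P) (τ : ℝ) (T : ℕ) :
    AEMeasurable (fun ω ↦ gridPath τ T (W · ω)) P :=
  aemeasurable_pi_lambda _ fun _ ↦ (hW.hasGaussianLaw_eval (min_le_left _ _)).aemeasurable

lemma IsWienerOn.aemeasurable_scaledPath {Ω : Type*} [MeasurableSpace Ω] {P : Measure Ω}
    {T : ℕ} {W : ℝ≥0 → Ω → ℝ} (hW : IsWienerOn ((T : ℝ≥0) / 2) W P) (τ : ℝ) :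
    AEMeasurable (fun ω ↦ scaledPath τ T (W · ω)) P :=
  aemeasurable_pi_lambda _ fun s ↦
    (hW.hasGaussianLaw_eval (le_half_of_mem_halfGrid s.2)).aemeasurable.const_mul _

theorem IsWienerOn.identDistrib_scaledPath {Ω Ω' : Type*} [MeasurableSpace Ω] [MeasurableSpace Ω']
    {P : Measure Ω} {P' : Measure Ω'} {T : ℕ} {W B : ℝ≥0 → _ → ℝ}
    (hW : IsWienerOn ((T : ℝ≥0) / 2) W P) (hB : IsWienerOn 1 B P') {τ : ℝ} (hτ : 0 < τ)
    (hT : τ ≤ T / 2) :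
    IdentDistrib (fun ω ↦ scaledPath τ T (W · ω)) (fun ω ↦ gridPath τ T (B · ω)) P P' := by
  have hs (s : halfGrid τ T) : τ.toNNReal ≤ s := by
    rw [Real.toNNReal_le_iff_le_coe]
    exact le_of_mem_halfGrid hT s.2
  have hs0 (s : halfGrid τ T) : 0 < (s : ℝ≥0) := (Real.toNNReal_pos.2 hτ).trans_le (hs s)
  have h := hW.identDistrib_inversion hB hs0 (fun s ↦ le_half_of_mem_halfGrid s.2)
    (fun s ↦ div_le_one_of_le₀ (hs s) zero_le)
  have e : (fun ω ↦ gridPath τ T (B · ω)) = fun ω (s : halfGrid τ T) ↦ B (τ.toNNReal / s) ω := by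
    funext ω s
    simp only [gridPath, min_eq_right (div_le_one_of_le₀ (hs s) zero_le)]
  rw [e]
  exact h

lemma IndepProcessesOn.indepFun_scaledPath {Ω : Type*} [MeasurableSpace Ω] {P : Measure Ω} {T : ℕ}
    {W W' : ℝ≥0 → Ω → ℝ} (h : IndepProcessesOn ((T : ℝ≥0) / 2) W W' P) (τ : ℝ) :
    IndepFun (fun ω ↦ scaledPath τ T (W · ω)) (fun ω ↦ scaledPath τ T (W' · ω)) P := by
  let φ : (Set.Icc (0 : ℝ≥0) ((T : ℝ≥0) / 2) → ℝ) → halfGrid τ T → ℝ := fun w s ↦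
    Real.sqrt τ.toNNReal / ((s : ℝ≥0) : ℝ) * w ⟨s, zero_le, le_half_of_mem_halfGrid s.2⟩
  have hφ : Measurable φ := measurable_pi_lambda _ fun s ↦ (measurable_pi_apply _).const_mul _
  exact IndepFun.comp h hφ hφ

/-! ### Limit law of the scaled paths -/

section Limit

variable {Ω₀ : Type*} [MeasurableSpace Ω₀] {P₀ : Measure Ω₀}
  {W : ℝ≥0 → Ω₀ → ℝ} {τ : ℕ → ℝ}

lemma IsWienerOn.ae_tendsto_norm_gridPath (hW : IsWienerOn 1 W P₀) (hτ : Tendsto τ atTop atTop)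
    (hτT : Tendsto (fun T : ℕ ↦ τ T / (T : ℝ)) atTop (𝓝 0)) :
    ∀ᵐ ω ∂P₀, Tendsto (fun T : ℕ ↦ ‖gridPath (τ T) T (W · ω)‖) atTop
      (𝓝 (⨆ u : Set.Icc (0 : ℝ≥0) 1, |W u ω|)) := by
  filter_upwards [hW.cont, hW.eval_zero] with ω hc h0
  exact tendsto_norm_gridPath hc h0 hτ hτT

lemma IsWienerOn.tendsto_measure_weightedNorm [IsProbabilityMeasure P₀] (hW : IsWienerOn 1 W P₀)
    (hτT : Tendsto (fun T : ℕ ↦ τ T / (T : ℝ)) atTop (𝓝 0)) {ε : ℝ} (hε : 0 < ε) :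
    Tendsto (fun T : ℕ ↦ P₀ {ω | ε ≤ weightedNorm (gridPath (τ T) T (W · ω))}) atTop (𝓝 0) := by
  have h : TendstoInMeasure P₀ (fun T ω ↦ weightedNorm (gridPath (τ T) T (W · ω))) atTop
      (fun _ ↦ 0) := by
    refine tendstoInMeasure_of_tendsto_ae (fun T ↦ (measurable_weightedNorm.comp_aemeasurable
      (hW.aemeasurable_gridPath _ _)).aestronglyMeasurable) ?_
    filter_upwards [hW.cont, hW.eval_zero] with ω hc h0
    exact tendsto_weightedNorm_gridPath hc h0 hτT
  refine (tendstoInMeasure_iff_norm.1 h ε hε).congr fun T ↦ ?_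
  simp only [sub_zero, Real.norm_of_nonneg (weightedNorm_nonneg _)]

/-- Limit law of the maximum of the norms of two independent scaled paths. -/
theorem tendstoInDistribution_max_norm_scaledPath {Ω : Type*} [MeasurableSpace Ω] {P : Measure Ω}
    [IsProbabilityMeasure P] [IsProbabilityMeasure P₀] {W₁ W₂ : ℕ → ℝ≥0 → Ω → ℝ}
    (hW₁ : ∀ T : ℕ, IsWienerOn ((T : ℝ≥0) / 2) (W₁ T) P)
    (hW₂ : ∀ T : ℕ, IsWienerOn ((T : ℝ≥0) / 2) (W₂ T) P)
    (hind : ∀ T : ℕ, IndepProcessesOn ((T : ℝ≥0) / 2) (W₁ T) (W₂ T) P)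
    (hτ : Tendsto τ atTop atTop) (hτT : Tendsto (fun T : ℕ ↦ τ T / (T : ℝ)) atTop (𝓝 0))
    (hW : IsWienerOn 1 W P₀) {Ω' : Type*} [MeasurableSpace Ω'] {P' : Measure Ω'}
    [IsProbabilityMeasure P'] {ξ₁ ξ₂ : Ω' → ℝ} (hξ : IndepFun ξ₁ ξ₂ P')
    (hξ₁ : IdentDistrib ξ₁ (fun ω ↦ ⨆ u : Set.Icc (0 : ℝ≥0) 1, |W u ω|) P' P₀)
    (hξ₂ : IdentDistrib ξ₂ (fun ω ↦ ⨆ u : Set.Icc (0 : ℝ≥0) 1, |W u ω|) P' P₀) :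
    TendstoInDistribution (fun (T : ℕ) (ω : Ω) ↦
      max ‖scaledPath (τ T) T (W₁ T · ω)‖ ‖scaledPath (τ T) T (W₂ T · ω)‖)
      atTop (fun ω' ↦ max (ξ₁ ω') (ξ₂ ω')) (fun _ ↦ P) P' := by
  set ζ : Ω₀ → ℝ := fun ω ↦ ⨆ u : Set.Icc (0 : ℝ≥0) 1, |W u ω| with hζ
  have hζm : AEMeasurable ζ P₀ := hξ₁.aemeasurable_snd
  have ident_fst {α : Type _} [MeasurableSpace α] {f : Ω₀ → α} (hf : AEMeasurable f P₀) :
      IdentDistrib f (fun ω : Ω₀ × Ω₀ ↦ f ω.1) P₀ (P₀.prod P₀) :=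
    ⟨hf, hf.comp_fst, by
      rw [← Function.comp_def, ← AEMeasurable.map_map_of_aemeasurable (by simpa using hf)
        measurable_fst.aemeasurable, Measure.map_fst_prod, measure_univ, one_smul]⟩
  have ident_snd {α : Type _} [MeasurableSpace α] {f : Ω₀ → α} (hf : AEMeasurable f P₀) :
      IdentDistrib f (fun ω : Ω₀ × Ω₀ ↦ f ω.2) P₀ (P₀.prod P₀) :=
    ⟨hf, hf.comp_snd, by
      rw [← Function.comp_def, ← AEMeasurable.map_map_of_aemeasurable (by simpa using hf)
        measurable_snd.aemeasurable, Measure.map_snd_prod, measure_univ, one_smul]⟩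
  have hg (T : ℕ) := hW.aemeasurable_gridPath (τ T) T
  -- On the product space the two paths do not depend on `T`, so almost sure convergence of the grid
  -- maxima is available.
  have base : TendstoInDistribution (fun (T : ℕ) (ω : Ω₀ × Ω₀) ↦
      max ‖gridPath (τ T) T (W · ω.1)‖ ‖gridPath (τ T) T (W · ω.2)‖) atTop
      (fun ω ↦ max (ζ ω.1) (ζ ω.2)) (fun _ ↦ P₀.prod P₀) (P₀.prod P₀) := by
    refine tendstoInDistribution_of_ae_tendsto
      (fun T ↦ (hg T).norm.comp_fst.max (hg T).norm.comp_snd)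
      (hζm.comp_fst.max hζm.comp_snd) ?_
    have h := hW.ae_tendsto_norm_gridPath hτ hτT
    filter_upwards [Measure.quasiMeasurePreserving_fst.ae h,
      Measure.quasiMeasurePreserving_snd.ae h] with ω h1 h2
    exact h1.max h2
  refine tendstoInDistribution_of_eventually_identDistrib base
    (fun T ↦ ((hW₁ T).aemeasurable_scaledPath _).norm.max ((hW₂ T).aemeasurable_scaledPath _).norm)
    ?_ ?_
  -- Inversion gives the marginal laws and independence the joint law; `τ ≤ T/2` holds only
  -- eventually.
  · filter_upwards [hτ.eventually_gt_atTop 0, eventually_le_half hτT (one_half_pos (α := ℝ))]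
      with T h0 hT
    rw [one_div_mul_eq_div] at hT
    have h1 := ((hW₁ T).identDistrib_scaledPath hW h0 hT).trans (ident_fst (hg T))
    have h2 := ((hW₂ T).identDistrib_scaledPath hW h0 hT).trans (ident_snd (hg T))
    exact (h1.prodMk h2 ((hind T).indepFun_scaledPath _) (indepFun_prod₀ (hg T) (hg T))).comp
      (u := fun y ↦ max ‖y.1‖ ‖y.2‖) (by fun_prop)
  · exact ((hξ₁.trans (ident_fst hζm)).prodMk (hξ₂.trans (ident_snd hζm)) hξ
      (indepFun_prod₀ hζm hζm)).comp (u := fun y : ℝ × ℝ ↦ max y.1 y.2) (by fun_prop)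

end Limit

/-! ### The limit theorem -/

theorem theorem2p1
    {Ω : Type*} [MeasurableSpace Ω] (P : Measure Ω) [IsProbabilityMeasure P]
    -- the location model `X_t = μ_t + e_t` with centred errors
    (X e : ℕ → Ω → ℝ) (μ : ℕ → ℝ)
    (hX : ∀ t, 1 ≤ t → ∀ ω, X t ω = μ t + e t ω)
    (he : ∀ t, 1 ≤ t → Integrable (e t) P ∧ ∫ ω, e t ω ∂P = 0)
    -- the null hypothesis `μ_1 = ⋯ = μ_T`, for every sample size `T`
    (hH0 : ∀ T : ℕ, ∀ s ∈ Finset.Icc 1 T, ∀ t ∈ Finset.Icc 1 T, μ s = μ t)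
    -- the trimming parameter `t_T`
    (τ : ℕ → ℝ) (hτ : Tendsto τ atTop atTop)
    (hτT : Tendsto (fun T : ℕ ↦ τ T / (T : ℝ)) atTop (𝓝 0))
    -- the Gaussian approximation from both ends
    (σ κ : ℝ) (hσ : 0 < σ) (hκ0 : 0 < κ) (hκ : κ < 1 / 2)
    (happrox : HasTwoSidedApprox e σ κ P)
    -- a Wiener process on `[0, 1]`, and two independent copies `ξ₁`, `ξ₂` of `sup |W|`
    {Ω₀ : Type*} [MeasurableSpace Ω₀] (P₀ : Measure Ω₀) [IsProbabilityMeasure P₀]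
    (W : ℝ≥0 → Ω₀ → ℝ) (hW : IsWienerOn 1 W P₀)
    {Ω' : Type*} [MeasurableSpace Ω'] (P' : Measure Ω') [IsProbabilityMeasure P']
    (ξ₁ ξ₂ : Ω' → ℝ) (hξ : IndepFun ξ₁ ξ₂ P')
    (hξ₁ : IdentDistrib ξ₁ (fun ω ↦ ⨆ u : Set.Icc (0 : ℝ≥0) 1, |W u ω|) P' P₀)
    (hξ₂ : IdentDistrib ξ₂ (fun ω ↦ ⨆ u : Set.Icc (0 : ℝ≥0) 1, |W u ω|) P' P₀) :
    TendstoInDistribution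
      (fun (T : ℕ) (ω : Ω) ↦ Real.sqrt (τ T) * (renyiStat (fun s ↦ X s ω) (τ T) T / σ))
      atTop (fun ω' ↦ max (ξ₁ ω') (ξ₂ ω')) (fun _ ↦ P) P' := by
  obtain ⟨W₁, W₂, hWW, hfwd, hbwd⟩ := happrox
  have hW₁ (T : ℕ) := (hWW T).1
  have hW₂ (T : ℕ) := (hWW T).2.1
  have hXm (t : ℕ) (ht : 1 ≤ t) : AEMeasurable (X t) P := by
    rw [show X t = fun ω ↦ μ t + e t ω from funext (hX t ht)]
    exact (he t ht).1.aestronglyMeasurable.aemeasurable.const_add _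
  -- Slutsky: it remains to show that the difference from the maximum of the scaled paths tends to
  -- `0` in probability.
  refine tendstoInDistribution_of_tendstoInMeasure_sub _ _
    (tendstoInDistribution_max_norm_scaledPath hW₁ hW₂ (fun T ↦ (hWW T).2.2) hτ hτT hW hξ hξ₁ hξ₂)
    ?_ (fun T ↦ ((aemeasurable_renyiStat hXm _ _).div_const _).const_mul _)
  rw [tendstoInMeasure_iff_norm]
  intro ε hε
  rw [ENNReal.tendsto_nhds_zero]
  intro η hη
  have hη4 : 0 < η / 4 := ENNReal.div_pos hη.ne' (by norm_num)
  obtain ⟨M₁, hM₁⟩ := hfwd (η / 4) hη4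
  obtain ⟨M₂, hM₂⟩ := hbwd (η / 4) hη4
  set M : ℝ≥0 := max M₁ M₂ with hM
  have herr : Tendsto (fun T ↦ 4 * (Real.sqrt (τ T) * (M * τ T ^ (κ - 1)) / σ)) atTop (𝓝 0) := by
    have h1 : Tendsto (fun T ↦ 4 * (M / σ) * τ T ^ (-(1 / 2 - κ))) atTop (𝓝 (4 * (M / σ) * 0)) :=
      ((tendsto_rpow_neg_atTop (by linarith)).comp hτ).const_mul _
    rw [mul_zero] at h1
    refine h1.congr' ?_
    filter_upwards [hτ.eventually_gt_atTop 0] with T hT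
    rw [show -(1 / 2 - κ) = 1 / 2 + (κ - 1) by ring, Real.rpow_add hT, ← Real.sqrt_eq_rpow]
    ring
  -- Two weighted norms below `ε/16`, with the factor `4`, contribute less than `ε/2`; the
  -- approximation error takes the other half.
  have hG := ENNReal.tendsto_nhds_zero.1
    (hW.tendsto_measure_weightedNorm hτT (show (0 : ℝ) < ε / 16 by positivity)) (η / 4) hη4
  filter_upwards [hM₁, hM₂, hG, herr.eventually_lt_const (half_pos hε), hτ.eventually_ge_atTop 1,
    eventually_le_half hτT (one_half_pos (α := ℝ))] with T h₁ h₂ h₃ h₄ hτ1 hT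
  rw [one_div_mul_eq_div] at hT
  have hτ0 : 0 < τ T := by linarith
  have hGW {w : ℝ≥0 → Ω → ℝ} (hw : IsWienerOn ((T : ℝ≥0) / 2) w P) :
      P {ω | ε / 16 ≤ weightedNorm (scaledPath (τ T) T (w · ω))} ≤ η / 4 := by
    refine le_trans (le_of_eq ?_) h₃
    exact ((hw.identDistrib_scaledPath hW hτ0 hT).comp measurable_weightedNorm).measure_mem_eq
      measurableSet_Ici
  -- A large difference forces one of four bad events, each of probability at most `η/4`.
  have hsub : {ω | ε ≤ ‖((fun (T : ℕ) (ω : Ω) ↦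
        Real.sqrt (τ T) * (renyiStat (fun s ↦ X s ω) (τ T) T / σ)) - fun (T : ℕ) (ω : Ω) ↦
        max ‖scaledPath (τ T) T (W₁ T · ω)‖ ‖scaledPath (τ T) T (W₂ T · ω)‖) T ω
          - (0 : ℕ → Ω → ℝ) T ω‖} ⊆
      ({ω | (M₁ : ℝ≥0∞) < forwardError e σ κ (W₁ T) T ω} ∪
        {ω | (M₂ : ℝ≥0∞) < backwardError e σ κ (W₂ T) T ω}) ∪
      ({ω | ε / 16 ≤ weightedNorm (scaledPath (τ T) T (W₁ T · ω))} ∪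
        {ω | ε / 16 ≤ weightedNorm (scaledPath (τ T) T (W₂ T · ω))}) := by
    intro ω hω
    by_contra hcon
    simp only [Set.mem_union, Set.mem_ofPred_eq, not_or, not_lt, not_le] at hcon
    obtain ⟨⟨c₁, c₂⟩, c₃, c₄⟩ := hcon
    have hM₁M : (M₁ : ℝ≥0∞) ≤ M := by exact_mod_cast le_max_left M₁ M₂
    have hM₂M : (M₂ : ℝ≥0∞) ≤ M := by exact_mod_cast le_max_right M₁ M₂
    have key := abs_renyiStat_sub_le (e := (e · ω)) (w₁ := (W₁ T · ω)) (w₂ := (W₂ T · ω))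
      (κ := κ) hτ1 hT hσ (by linarith) M.coe_nonneg
      (forall_le_of_forwardError_le (c₁.trans hM₁M)) (forall_le_of_backwardError_le (c₂.trans hM₂M))
    have hX1 : ∀ s, 1 ≤ s → X s ω = μ 1 + e s ω := fun s hs ↦ by
      rw [hX s hs, hH0 s s (by simp [hs]) 1 (by simp [hs])]
    rw [← renyiStat_const_add (y := fun s ↦ X s ω) hX1 hτ0] at key
    have hω' : ε ≤ |Real.sqrt (τ T) * (renyiStat (fun s ↦ X s ω) (τ T) T / σ) -
        max ‖scaledPath (τ T) T (W₁ T · ω)‖ ‖scaledPath (τ T) T (W₂ T · ω)‖| := by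
      simpa using hω
    linarith
  calc _ ≤ _ := measure_mono hsub
    _ ≤ (η / 4 + η / 4) + (η / 4 + η / 4) :=
      (measure_union_le _ _).trans (add_le_add
        ((measure_union_le _ _).trans (add_le_add h₁ h₂))
        ((measure_union_le _ _).trans (add_le_add (hGW (hW₁ T)) (hGW (hW₂ T)))))
    _ = 4 * (η / 4) := by ring
    _ = η := ENNReal.mul_div_cancel (by norm_num) (by norm_num)
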